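/- A continuum is a nonempty compact connected metric space. For a continuum $X$ let $2^X$ be the set of nonempty closed subsets of $X$ with the Hausdorff metric $\mathcal H$, and let $C(X)\subset 2^X$ be the set of connected elements (subcontinua). A set $A\in 2^X\setminus\{X\}$ is a shore set if for every $\varepsilon>0$ there is $B\in C(X)$ with $\mathcal H(B,X)<\varepsilon$ and $B\cap A=\emptyset$; a point $p$ is a shore point if $\{p\}$ is a shore set. For $A,B\in 2^X$, $B$ does not block $A$ if there is a continuous $\gamma:[0,1]\to 2^X$ with $\gamma(0)=A$, $\gamma(1)=X$ and $\gamma(t)\cap B=\emptyset$ for all $t<1$. A nonblocker (of singletons) is a set $A\in 2^X\setminus\{X\}$ that does not block $\{x\}$ for any $x\in X\setminus A$; let $\mathcal{CNB}(\mathcal F_1(X))$ be the set of connected nonblockers. For $a\in X$ let $\pi(a)$ be the intersection of all nonblockers containing $a$ if there are any, and $\pi(a)=X$ otherwise, and let $\Lambda_X=\{\pi(a):a\in X\}$. A dendroid is an arcwise connected continuum $X$ that is hereditarily unicoherent, i.e. for every subcontinuum $K$ of $X$ and all subcontinua $P,Q$ with $P\cup Q=K$, the set $P\cap Q$ is connected.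 Theorem. Let $X$ be a dendroid that has a point which is not a shore point. Then $$\Lambda_X=\mathcal{CNB}(\mathcal F_1(X))\cup\{X\}.$$ Equivalently, $\Lambda_X$ equals the set of connected nonblockers if $X$ itself is (vacuously) counted as a nonblocker. -/

import Mathlib

open TopologicalSpace

namespace Continuum

/-- The hyperspace `C(X)` of subcontinua. The hyperspace `2^X` of nonempty closed subsets of a
compact metric space `X` is `NonemptyCompacts X`, whose distance is the Hausdorff metric. -/
def subcontinua (X : Type*) [MetricSpace X] : Set (NonemptyCompacts X) :=
  {A | IsConnected (A : Set X)}

/-- The hyperspace `F₁(X)` of singletons. -/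
def singletons (X : Type*) [MetricSpace X] : Set (NonemptyCompacts X) :=
  Set.range fun x : X => ({x} : NonemptyCompacts X)

/-- A continuum `K` in `X` is unicoherent: whenever it is the union of two subcontinua,
their intersection is connected. -/
def IsUnicoherent {X : Type*} [MetricSpace X] (K : NonemptyCompacts X) : Prop :=
  ∀ A ∈ subcontinua X, ∀ B ∈ subcontinua X, (A : Set X) ∪ B = K →
    IsConnected ((A : Set X) ∩ B)

/-- Any two distinct points are the end points of an arc, that is, of an injective path. -/
def IsArcwiseConnected (X : Type*) [MetricSpace X] : Prop :=
  ∀ x y : X, x ≠ y → ∃ γ : Path x y, Function.Injective γ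

/-- A dendroid: an arcwise connected, hereditarily unicoherent continuum. -/
structure IsDendroid (X : Type*) [MetricSpace X] [CompactSpace X] [ConnectedSpace X] : Prop where
  arcwise : IsArcwiseConnected X
  hereditarilyUnicoherent : ∀ K ∈ subcontinua X, IsUnicoherent K

section Hyperspace

variable (X : Type*) [MetricSpace X] [CompactSpace X] [ConnectedSpace X]

/-- `S(X)`: the shore sets of `X`. Here `⊤` is `X` as an element of `2^X`. -/
def shoreSets : Set (NonemptyCompacts X) :=
  {A | A ≠ ⊤ ∧ ∀ ε : ℝ, 0 < ε → ∃ B ∈ subcontinua X, dist B ⊤ < ε ∧ (B : Set X) ∩ A = ∅}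

/-- `S₁(X) = S(X) ∩ F₁(X)`. -/
def shoreSingletons : Set (NonemptyCompacts X) :=
  shoreSets X ∩ singletons X

variable {X}

/-- `B` blocks `A`: no path in `2^X` from `A` to `X` stays disjoint from `B` before time `1`. -/
def Blocks (B A : NonemptyCompacts X) : Prop :=
  ∀ γ : Path A (⊤ : NonemptyCompacts X), ∃ t : unitInterval, t < 1 ∧ ((γ t : Set X) ∩ B).Nonempty

variable (X)

/-- `NB(F₁(X))`: the proper nonempty closed sets that block no point of their complement. -/
def nonblockers : Set (NonemptyCompacts X) :=
  {A | A ≠ ⊤ ∧ ∀ x : X, x ∉ A → ¬ Blocks A {x}}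

/-- `CNB(F₁(X)) = NB(F₁(X)) ∩ C(X)`. -/
def connectedNonblockers : Set (NonemptyCompacts X) :=
  nonblockers X ∩ subcontinua X

variable {X}

/-- `NB(a, F₁(X))`: the nonblockers containing `a`. -/
def nonblockersAt (a : X) : Set (NonemptyCompacts X) :=
  {A | A ∈ nonblockers X ∧ a ∈ A}

open Classical in
/-- `π(a)`: the intersection of all nonblockers containing `a`, or `X` if there are none. -/
noncomputable def minNonblocker (a : X) : NonemptyCompacts X :=
  if (nonblockersAt a).Nonempty then
    { carrier := ⋂ A ∈ nonblockersAt a, (A : Set X)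
      isCompact' := (isClosed_biInter fun A _ => A.isCompact.isClosed).isCompact
      nonempty' := ⟨a, Set.mem_iInter₂.2 fun _ hA => hA.2⟩ }
  else ⊤

variable (X)

/-- `Λ_X`: the set of all `π(a)`. -/
def minNonblockers : Set (NonemptyCompacts X) :=
  Set.range fun a : X => minNonblocker a

end Hyperspace

end Continuum

/-!
Fix a point `p` that is not a shore point and order the dendroid as a tree rooted at `p`, where
`a ≤ x` means that `a` lies on the arc from `p` to `x`. A proper closed set is a nonblocker if and
only if it is an upper set with dense complement. Indeed, a path in the hyperspace from `{x}` to
`X` yields subcontinua that contain `x`, avoid `A` and are arbitrarily close to `X`; eventually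
they contain `p`, hence the whole arc from `p` to `x`. Conversely, the complement of an upper set
is path connected through `p`, and following a ray that runs through a dense sequence of the
complement gives a path to `X` in the hyperspace.

Upper sets are stable under intersections and under passing to components, so `π(a)` is a connected
nonblocker as soon as some nonblocker contains `a`. A connected nonblocker `A` has a least element
`a`, and every upper set that contains `a` contains `A`, so `π(a) = A`. No nonblocker contains `p`,
so `π(p) = X`.
-/

namespace Continuum

open Set Filter Topology

theorem isClosed_connectedComponentIn {X : Type*} [TopologicalSpace X] {A : Set X}
    (hA : IsClosed A) (a : X) : IsClosed (connectedComponentIn A a) := by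
  by_cases ha : a ∈ A
  · have hsub := closure_minimal (connectedComponentIn_subset A a) hA
    exact isClosed_of_closure_subset <| isPreconnected_connectedComponentIn.closure
      |>.subset_connectedComponentIn (subset_closure (mem_connectedComponentIn ha)) hsub
  · exact connectedComponentIn_eq_empty ha ▸ isClosed_empty

/-! ### Arcs in hereditarily unicoherent spaces -/

section ArcHull

variable {X : Type*} [TopologicalSpace X]

/-- Hereditary unicoherence of a topological space, stated for all closed connected sets. For
compact metric spaces this is the condition in `IsDendroid`: sets with empty intersection are
harmless because the empty set is preconnected. -/
def IsHereditarilyUnicoherent (X : Type*) [TopologicalSpace X] : Prop :=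
  ∀ ⦃K L : Set X⦄, IsClosed K → IsClosed L → IsPreconnected K → IsPreconnected L →
    IsPreconnected (K ∩ L)

/-- The intersection of all closed connected sets containing `x` and `y`. In a dendroid it is the
unique arc from `x` to `y`. -/
def arcHull (x y : X) : Set X :=
  ⋂₀ {K | IsClosed K ∧ IsPreconnected K ∧ x ∈ K ∧ y ∈ K}

theorem arcHull_subset {x y : X} {K : Set X} (hK : IsClosed K) (hc : IsPreconnected K)
    (hx : x ∈ K) (hy : y ∈ K) : arcHull x y ⊆ K :=
  sInter_subset_of_mem ⟨hK, hc, hx, hy⟩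

theorem left_mem_arcHull (x y : X) : x ∈ arcHull x y := fun _ hK => hK.2.2.1

theorem right_mem_arcHull (x y : X) : y ∈ arcHull x y := fun _ hK => hK.2.2.2

theorem isClosed_arcHull (x y : X) : IsClosed (arcHull x y) :=
  isClosed_sInter fun _ hK => hK.1

theorem arcHull_self [T1Space X] (x : X) : arcHull x x = {x} :=
  (arcHull_subset isClosed_singleton isPreconnected_singleton rfl rfl).antisymm
    (singleton_subset_iff.2 (left_mem_arcHull x x))

theorem IsHereditarilyUnicoherent.arcHull_eq_image_Icc [T2Space X]
    (hX : IsHereditarilyUnicoherent X) {ι : Type*} [ConditionallyCompleteLinearOrder ι]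
    [TopologicalSpace ι] [OrderTopology ι] [DenselyOrdered ι] [CompactSpace ι] {f : ι → X}
    (hf : Continuous f) (hinj : Function.Injective f) {s t : ι} (hst : s ≤ t) :
    arcHull (f s) (f t) = f '' Icc s t := by
  refine (arcHull_subset (isClosed_Icc.isCompact.image hf).isClosed
    (isPreconnected_Icc.image f hf.continuousOn) (mem_image_of_mem f (left_mem_Icc.2 hst))
    (mem_image_of_mem f (right_mem_Icc.2 hst))).antisymm (subset_sInter ?_)
  rintro K ⟨hK, hKc, hs, ht⟩
  have hrange : IsPreconnected (K ∩ range f) :=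
    hX hK hf.isClosedMap.isClosed_range hKc (isPreconnected_range hf)
  have hpre : IsPreconnected (f ⁻¹' K) := by
    simpa only [preimage_inter, preimage_range, inter_univ] using
      hrange.preimage_of_isClosedMap hinj hf.isClosedMap inter_subset_right
  exact image_subset_iff.2 (hpre.ordConnected.out hs ht)

/-- Upper sets for the relation "`a` lies on the arc from `p` to `x`", which orders a dendroid
as a tree rooted at `p`. -/
def IsArcUpperSet (p : X) (A : Set X) : Prop :=
  ∀ ⦃a x : X⦄, a ∈ arcHull p x → a ∈ A → x ∈ A

variable {p : X} {A : Set X}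

theorem IsArcUpperSet.arcHull_subset_compl (hA : IsArcUpperSet p A) {x : X} (hx : x ∉ A) :
    arcHull p x ⊆ Aᶜ :=
  fun _ ha haA => hx (hA ha haA)

theorem IsArcUpperSet.eq_univ_of_mem (hA : IsArcUpperSet p A) (hp : p ∈ A) : A = univ :=
  eq_univ_of_forall fun x => hA (left_mem_arcHull p x) hp

theorem IsArcUpperSet.biInter {ι : Type*} {I : Set ι} {A : ι → Set X}
    (hA : ∀ i ∈ I, IsArcUpperSet p (A i)) : IsArcUpperSet p (⋂ i ∈ I, A i) :=
  fun _ _ hax ha => mem_iInter₂.2 fun i hi => hA i hi hax (mem_iInter₂.1 ha i hi)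

end ArcHull

/-! ### Arcs in dendroids -/

namespace IsDendroid

variable {X : Type*} [MetricSpace X] [CompactSpace X] [ConnectedSpace X]

theorem isHereditarilyUnicoherent (hX : IsDendroid X) : IsHereditarilyUnicoherent X := by
  intro K L hK hL hKc hLc
  rcases (K ∩ L).eq_empty_or_nonempty with h | ⟨x, hxK, hxL⟩
  · exact h ▸ isPreconnected_empty
  let A : NonemptyCompacts X := ⟨⟨K, hK.isCompact⟩, ⟨x, hxK⟩⟩
  let B : NonemptyCompacts X := ⟨⟨L, hL.isCompact⟩, ⟨x, hxL⟩⟩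
  have hAB : A ⊔ B ∈ subcontinua X := by
    refine ⟨(A ⊔ B).nonempty, ?_⟩
    rw [NonemptyCompacts.coe_sup]
    exact hKc.union x hxK hxL hLc
  exact (hX.hereditarilyUnicoherent _ hAB A ⟨A.nonempty, hKc⟩ B ⟨B.nonempty, hLc⟩
    (NonemptyCompacts.coe_sup A B).symm).isPreconnected

theorem arcHull_eq_image_Icc (hX : IsDendroid X) {x y : X} {γ : Path x y}
    (hγ : Function.Injective γ) {s t : unitInterval} (hst : s ≤ t) :
    arcHull (γ s) (γ t) = γ '' Icc s t :=
  hX.isHereditarilyUnicoherent.arcHull_eq_image_Icc γ.continuous hγ hst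

theorem exists_path_range_eq_arcHull (hX : IsDendroid X) (x y : X) :
    ∃ γ : Path x y, range γ = arcHull x y := by
  by_cases hxy : x = y
  · subst hxy
    exact ⟨Path.refl x, by rw [Path.refl_range, arcHull_self]⟩
  obtain ⟨γ, hγ⟩ := hX.arcwise x y hxy
  have huniv : Icc (0 : unitInterval) 1 = univ := Icc_bot_top
  have h := hX.arcHull_eq_image_Icc hγ zero_le_one
  rw [γ.source, γ.target, huniv, image_univ] at h
  exact ⟨γ, h.symm⟩

theorem isPreconnected_arcHull (hX : IsDendroid X) (x y : X) : IsPreconnected (arcHull x y) := by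
  obtain ⟨γ, hγ⟩ := hX.exists_path_range_eq_arcHull x y
  exact hγ ▸ isPreconnected_range γ.continuous

theorem mem_arcHull_of_mem_arcHull (hX : IsDendroid X) {p x y z : X} (hx : x ∈ arcHull p y)
    (hz : z ∈ arcHull x y) : x ∈ arcHull p z := by
  by_cases hpy : p = y
  · obtain rfl : x = p := by simpa [hpy, arcHull_self] using hx
    exact left_mem_arcHull x z
  obtain ⟨γ, hγ⟩ := hX.arcwise p y hpy
  have hpart {s t : unitInterval} (hst : s ≤ t) := hX.arcHull_eq_image_Icc hγ hst
  obtain ⟨s, hs, rfl⟩ : x ∈ γ '' Icc 0 1 := by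
    rwa [← hpart zero_le_one, γ.source, γ.target]
  obtain ⟨t, ht, rfl⟩ : z ∈ γ '' Icc s 1 := by
    rwa [← hpart hs.2, γ.target]
  have hpz := hpart (hs.1.trans ht.1)
  rw [γ.source] at hpz
  exact hpz ▸ mem_image_of_mem γ ⟨hs.1, ht.1⟩

theorem isArcUpperSet_connectedComponentIn (hX : IsDendroid X) {p : X} {A : Set X}
    (hA : IsArcUpperSet p A) (a : X) : IsArcUpperSet p (connectedComponentIn A a) := by
  intro z x hzx hz
  have hsub : arcHull z x ⊆ A := fun w hw =>
    hA (hX.mem_arcHull_of_mem_arcHull hzx hw) (connectedComponentIn_subset A a hz)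
  rw [connectedComponentIn_eq hz]
  exact (hX.isPreconnected_arcHull z x).subset_connectedComponentIn (left_mem_arcHull z x) hsub
    (right_mem_arcHull z x)

/-- The witness is the first point of `A` on the arc from `p` to some point of `A`. -/
theorem exists_mem_forall_mem_arcHull (hX : IsDendroid X) (p : X) {A : Set X}
    (hA : IsClosed A) (hAc : IsConnected A) : ∃ a ∈ A, ∀ y ∈ A, a ∈ arcHull p y := by
  obtain ⟨x, hx⟩ := hAc.nonempty
  obtain ⟨γ, hγ⟩ := hX.exists_path_range_eq_arcHull p x
  obtain ⟨t, htA, ht⟩ := (hA.preimage γ.continuous).isCompact.exists_isLeast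
    ⟨1, by rwa [mem_preimage, γ.target]⟩
  refine ⟨γ t, htA, fun y hy => ?_⟩
  have hcover : arcHull p x ⊆ arcHull p y ∪ A :=
    arcHull_subset ((isClosed_arcHull p y).union hA)
      ((hX.isPreconnected_arcHull p y).union y (right_mem_arcHull p y) hy hAc.isPreconnected)
      (Or.inl (left_mem_arcHull p y)) (Or.inr hx)
  have hbefore : Ico 0 t ⊆ γ ⁻¹' arcHull p y := fun s hs =>
    (hcover (hγ ▸ mem_range_self s)).resolve_right fun hsA => hs.2.not_ge (ht hsA)
  rcases eq_or_ne 0 t with rfl | h0t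
  · rw [γ.source]
    exact left_mem_arcHull p y
  · have hclosure := closure_minimal hbefore ((isClosed_arcHull p y).preimage γ.continuous)
    rw [closure_Ico h0t] at hclosure
    exact hclosure (right_mem_Icc.2 t.2.1)

end IsDendroid

/-! ### Paths in the hyperspace ending at the whole space -/

theorem continuous_apply_floor_fract {Y : Type*} [TopologicalSpace Y] {g : ℤ → ℝ → Y}
    (hg : ∀ n, Continuous (g n)) (hglue : ∀ n, g n 1 = g (n + 1) 0) :
    Continuous fun s => g ⌊s⌋ (Int.fract s) := by
  have heq (n : ℤ) :
      EqOn (fun s => g ⌊s⌋ (Int.fract s)) (fun s => g n (s - n)) (Icc n (n + 1)) := by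
    rintro s ⟨h1, h2⟩
    rcases h2.eq_or_lt with rfl | h2
    · simp [hglue]
    · simp only [Int.fract, Int.floor_eq_iff.2 ⟨h1, h2⟩]
  have hfinite : LocallyFinite fun n : ℤ => Icc (n : ℝ) (n + 1) :=
    locallyFinite_Icc_of_tendsto tendsto_intCast_atTop_atTop
      (tendsto_atBot_add_const_right _ _ (tendsto_intCast_atBot_iff.2 tendsto_id))
  refine hfinite.continuous (iUnion_Icc_intCast ℝ) (fun _ => isClosed_Icc) fun n => ?_
  exact ((hg n).comp (continuous_sub_right (n : ℝ))).continuousOn.congr (heq n)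

theorem exists_continuous_forall_apply_intCast_eq {X : Type*} [TopologicalSpace X] {U : Set X}
    (hU : IsPathConnected U) {q : ℤ → X} (hq : ∀ n, q n ∈ U) :
    ∃ β : ℝ → X, Continuous β ∧ (∀ s, β s ∈ U) ∧ ∀ n : ℤ, β n = q n := by
  choose α hα using fun n => hU.joinedIn (q n) (hq n) (q (n + 1)) (hq (n + 1))
  refine ⟨fun s => (α ⌊s⌋).extend (Int.fract s),
    continuous_apply_floor_fract (fun n => (α n).continuous_extend) (by simp), fun s => ?_,
    by simp⟩
  have hmem : (α ⌊s⌋).extend (Int.fract s) ∈ range (α ⌊s⌋) :=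
    Path.extend_range (α ⌊s⌋) ▸ mem_range_self _
  exact range_subset_iff.2 (hα ⌊s⌋) hmem

theorem exists_path_of_tendsto_atTop {Y : Type*} [TopologicalSpace Y] {f : ℝ → Y} {y : Y}
    (hf : Continuous f) (hy : Tendsto f atTop (𝓝 y)) :
    ∃ γ : Path (f 0) y, ∀ t < 1, γ t ∈ range f := by
  let φ (t : unitInterval) : ℝ := (1 - t : ℝ)⁻¹ - 1
  have hpos {t : unitInterval} (ht : t ≠ 1) : 0 < 1 - (t : ℝ) :=
    sub_pos.2 (unitInterval.lt_one_iff_ne_one.2 ht)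
  have hφ {t : unitInterval} (ht : t ≠ 1) : ContinuousAt φ t :=
    ((continuous_const.sub continuous_subtype_val).continuousAt.inv₀ (hpos ht).ne').sub
      continuousAt_const
  have hφ1 : Tendsto φ (𝓝[≠] 1) atTop := by
    refine tendsto_atTop_add_const_right _ _ (tendsto_inv_nhdsGT_zero.comp
      (tendsto_nhdsWithin_iff.2 ⟨?_, eventually_mem_of_tendsto_nhdsWithin tendsto_id |>.mono
        fun t ht => hpos ht⟩))
    have h : Continuous fun t : unitInterval => 1 - (t : ℝ) := by fun_prop
    simpa using (h.tendsto 1).mono_left nhdsWithin_le_nhds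
  let g : unitInterval → Y := Function.update (f ∘ φ) 1 y
  have hg : Continuous g := by
    refine continuous_iff_continuousAt.2 fun t => ?_
    rcases eq_or_ne t 1 with rfl | ht
    · exact continuousAt_update_same.2 (hy.comp hφ1)
    · exact (continuousAt_update_of_ne ht).2 (hf.continuousAt.comp (hφ ht))
  refine ⟨⟨⟨g, hg⟩, by simp [g, φ], by simp [g]⟩, fun t ht => ⟨φ t, ?_⟩⟩
  exact (Function.update_of_ne ht.ne y (f ∘ φ)).symm

section Hyperspace

variable {X : Type*} [TopologicalSpace X]

/-- The union `⋃ s ≤ t, γ s` of an initial part of a path in the hyperspace. It turns a path into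
an increasing one, keeps connectedness of the initial set, and still tends to the whole space if
`γ` does. -/
def initialUnion {K L : NonemptyCompacts X} (γ : Path K L) (t : unitInterval) :
    NonemptyCompacts X where
  carrier := ⋃ M ∈ γ '' Iic t, (M : Set X)
  isCompact' := NonemptyCompacts.isCompact_biUnion_coe_of_isCompact
    (isClosed_Iic.isCompact.image γ.continuous)
  nonempty' := (γ t).nonempty.mono (subset_biUnion_of_mem (mem_image_of_mem γ self_mem_Iic))

section InitialUnion

variable {K L : NonemptyCompacts X} (γ : Path K L)

theorem coe_initialUnion (t : unitInterval) :
    (initialUnion γ t : Set X) = ⋃ s ∈ Iic t, (γ s : Set X) :=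
  biUnion_image

theorem subset_initialUnion {s t : unitInterval} (hst : s ≤ t) :
    (γ s : Set X) ⊆ initialUnion γ t := by
  rw [coe_initialUnion]
  exact subset_biUnion_of_mem (u := fun s => (γ s : Set X)) hst

theorem isPreconnected_initialUnion (hK : IsPreconnected (K : Set X)) (t : unitInterval) :
    IsPreconnected (initialUnion γ t : Set X) := by
  let := TopologicalSpace.vietoris X
  rw [coe_initialUnion]
  exact vietoris.isPreconnected_biUnion isPreconnected_Iic
    (NonemptyCompacts.continuous_coe.comp γ.continuous).continuousOn
    ⟨0, t.2.1, by rwa [γ.source]⟩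

end InitialUnion

variable [CompactSpace X] [Nonempty X]

theorem tendsto_nhds_top_iff {ι : Type*} {l : Filter ι} {K : ι → NonemptyCompacts X} :
    Tendsto K l (𝓝 ⊤) ↔
      ∀ U : Set X, IsOpen U → U.Nonempty → ∀ᶠ i in l, ((K i : Set X) ∩ U).Nonempty := by
  refine ⟨fun h U hU hne => h ((NonemptyCompacts.isOpen_inter_nonempty_of_isOpen hU).mem_nhds
    (by simpa using hne)), fun h => ?_⟩
  let := TopologicalSpace.vietoris X
  rw [NonemptyCompacts.isEmbedding_coe.tendsto_nhds_iff, tendsto_nhds_generateFrom_iff]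
  rintro _ (⟨U, -, rfl⟩ | ⟨U, hU, rfl⟩) hmem
  · rw [NonemptyCompacts.coe_top, mem_powerset_iff, univ_subset_iff] at hmem
    exact Eventually.of_forall fun i => by simp [hmem]
  · exact h U hU (by simpa using hmem)

theorem tendsto_initialUnion {K : NonemptyCompacts X} (γ : Path K ⊤) :
    Tendsto (initialUnion γ) (𝓝 1) (𝓝 ⊤) := by
  refine tendsto_nhds_top_iff.2 fun U hU hne => ?_
  have hγ := γ.continuous.tendsto 1
  rw [γ.target] at hγ
  filter_upwards [tendsto_nhds_top_iff.1 hγ U hU hne] with t ht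
  exact ht.mono (inter_subset_inter_left U (subset_initialUnion γ le_rfl))

theorem exists_path_top_of_dense_image_Ici {β : ℝ → X} (hβ : Continuous β)
    (hd : Dense (β '' Ici 0)) :
    ∃ γ : Path ({β 0} : NonemptyCompacts X) ⊤, ∀ t < 1, (γ t : Set X) ⊆ range β := by
  let I : NonemptyCompacts ℝ := ⟨⟨Icc 0 1, isCompact_Icc⟩, ⟨0, by simp⟩⟩
  let K (s : ℝ) : NonemptyCompacts X := I.map (fun u => β (s * u)) (by fun_prop)
  have hK : Continuous K :=
    Continuous.nonemptyCompacts_map' (f := fun _ : ℝ => I) (g := fun s u => β (s * u))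
      continuous_const (by simp only [Function.uncurry_def]; fun_prop)
  have hK0 : K 0 = {β 0} := NonemptyCompacts.ext <| by
    simpa [K] using I.nonempty.image_const (β 0)
  have hmem {r s : ℝ} (hr : 0 ≤ r) (hs : 0 < s) (hrs : r ≤ s) : β r ∈ (K s : Set X) :=
    ⟨r / s, ⟨by positivity, (div_le_one hs).2 hrs⟩, congrArg β (mul_div_cancel₀ r hs.ne')⟩
  have hlim : Tendsto K atTop (𝓝 ⊤) := by
    refine tendsto_nhds_top_iff.2 fun U hU hne => ?_
    obtain ⟨_, hrU, r, hr, rfl⟩ := hd.inter_open_nonempty U hU hne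
    filter_upwards [eventually_gt_atTop 0, eventually_ge_atTop r] with s hs hrs
    exact ⟨β r, hmem hr hs hrs, hrU⟩
  obtain ⟨γ, hγ⟩ := exists_path_of_tendsto_atTop hK hlim
  refine ⟨γ.cast hK0.symm rfl, fun t ht => ?_⟩
  obtain ⟨s, hs⟩ := hγ t ht
  rw [Path.cast_coe, ← hs, NonemptyCompacts.coe_map]
  rintro _ ⟨u, -, rfl⟩
  exact mem_range_self _

theorem exists_path_top_of_isPathConnected_of_dense [SecondCountableTopology X] {U : Set X}
    (hU : IsPathConnected U) (hd : Dense U) {x : X} (hx : x ∈ U) :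
    ∃ γ : Path ({x} : NonemptyCompacts X) ⊤, ∀ t < 1, (γ t : Set X) ⊆ U := by
  have : Nonempty U := ⟨⟨x, hx⟩⟩
  obtain ⟨u, hu⟩ := exists_dense_seq U
  let q : ℕ → U := fun n => n.casesOn ⟨x, hx⟩ u
  obtain ⟨β, hβ, hβU, hβq⟩ :=
    exists_continuous_forall_apply_intCast_eq hU fun n : ℤ => (q n.toNat).2
  have hβ0 : β 0 = x := by simpa [q] using hβq 0
  have hdense : Dense (β '' Ici 0) := by
    refine (hd.denseRange_val.comp hu continuous_subtype_val).mono (range_subset_iff.2 fun n => ?_)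
    refine ⟨n + 1, mem_Ici.2 (by positivity), ?_⟩
    simpa [q] using hβq (n + 1 : ℕ)
  obtain ⟨γ, hγ⟩ := exists_path_top_of_dense_image_Ici hβ hdense
  exact ⟨γ.cast (by rw [hβ0]) rfl, fun t ht => (hγ t ht).trans (range_subset_iff.2 hβU)⟩

end Hyperspace

/-! ### Nonblockers of points -/

section Nonblockers

variable {X : Type*} [MetricSpace X] [CompactSpace X] [ConnectedSpace X]

theorem not_blocks_iff {A B : NonemptyCompacts X} :
    ¬ Blocks B A ↔
      ∃ γ : Path A (⊤ : NonemptyCompacts X), ∀ t < 1, (γ t : Set X) ⊆ (B : Set X)ᶜ := by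
  simp only [Blocks, not_forall, not_exists, not_and, not_nonempty_iff_eq_empty,
    subset_compl_iff_disjoint_right, disjoint_iff_inter_eq_empty]

theorem exists_subcontinuum_mem_of_not_blocks {A : NonemptyCompacts X} {x : X}
    (h : ¬ Blocks A {x}) {𝒰 : Set (NonemptyCompacts X)} (h𝒰 : 𝒰 ∈ 𝓝 ⊤) :
    ∃ B ∈ subcontinua X, B ∈ 𝒰 ∧ x ∈ B ∧ Disjoint (B : Set X) A := by
  obtain ⟨γ, hγ⟩ := not_blocks_iff.1 h
  have h1 : (1 : unitInterval) ∈ closure (Iio 1) := by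
    rw [closure_Iio' (a := (1 : unitInterval)) ⟨0, zero_lt_one⟩]
    exact self_mem_Iic
  obtain ⟨t, ht𝒰, ht1⟩ := mem_closure_iff_nhds.1 h1 _ (tendsto_initialUnion γ h𝒰)
  have hx : x ∈ (γ 0 : Set X) := by simp
  refine ⟨initialUnion γ t, ⟨(initialUnion γ t).nonempty, isPreconnected_initialUnion γ ?_ t⟩,
    ht𝒰, subset_initialUnion γ t.2.1 hx, ?_⟩
  · rw [NonemptyCompacts.coe_singleton]
    exact isPreconnected_singleton
  · rw [← subset_compl_iff_disjoint_right, coe_initialUnion]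
    exact iUnion₂_subset fun s hs => hγ s (lt_of_le_of_lt hs ht1)

theorem dense_compl_of_mem_nonblockers {A : NonemptyCompacts X} (hA : A ∈ nonblockers X) :
    Dense (A : Set X)ᶜ := by
  obtain ⟨x, hx⟩ : ∃ x, x ∉ A := by
    by_contra! h
    exact hA.1 (NonemptyCompacts.ext (eq_univ_of_forall h))
  refine dense_iff_inter_open.2 fun U hU hne => ?_
  obtain ⟨B, -, ⟨b, hbB, hbU⟩, -, hBA⟩ := exists_subcontinuum_mem_of_not_blocks (hA.2 x hx)
    (tendsto_nhds_top_iff.1 tendsto_id U hU hne)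
  exact ⟨b, hbU, disjoint_left.1 hBA hbB⟩

theorem mem_nonblockers_of_isPathConnected_compl {A : NonemptyCompacts X}
    (hA : IsPathConnected (A : Set X)ᶜ) (hd : Dense (A : Set X)ᶜ) : A ∈ nonblockers X := by
  refine ⟨?_, fun x hx => not_blocks_iff.2 (exists_path_top_of_isPathConnected_of_dense hA hd hx)⟩
  rintro rfl
  simpa using hA.nonempty

variable {p : X}

theorem eventually_mem_of_notMem_shoreSingletons
    (hp : ({p} : NonemptyCompacts X) ∉ shoreSingletons X) :
    ∀ᶠ B in 𝓝 (⊤ : NonemptyCompacts X), B ∈ subcontinua X → p ∈ B := by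
  by_cases htop : ({p} : NonemptyCompacts X) = ⊤
  · refine Eventually.of_forall fun B _ => ?_
    obtain ⟨b, hb⟩ := B.nonempty
    have hb' : b ∈ (⊤ : NonemptyCompacts X) := mem_univ b
    rw [← htop] at hb'
    obtain rfl : b = p := (NonemptyCompacts.mem_singleton b p).1 hb'
    exact hb
  by_contra hcon
  refine hp ⟨⟨htop, fun ε hε => ?_⟩, p, rfl⟩
  by_contra! h
  refine hcon (eventually_of_mem (Metric.ball_mem_nhds _ hε) fun B hB hBc => ?_)
  simpa using h B hBc hB

theorem isArcUpperSet_of_mem_nonblockers (hp : ({p} : NonemptyCompacts X) ∉ shoreSingletons X)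
    {A : NonemptyCompacts X} (hA : A ∈ nonblockers X) : IsArcUpperSet p (A : Set X) := by
  intro a x hax haA
  by_contra hx
  obtain ⟨B, hB, hpB, hxB, hBA⟩ := exists_subcontinuum_mem_of_not_blocks (hA.2 x hx)
    (eventually_mem_of_notMem_shoreSingletons hp)
  exact disjoint_left.1 hBA
    (arcHull_subset B.isCompact.isClosed hB.isPreconnected (hpB hB) hxB hax) haA

theorem IsDendroid.isPathConnected_compl (hX : IsDendroid X) {A : Set X}
    (hA : IsArcUpperSet p A) (hne : Aᶜ.Nonempty) : IsPathConnected Aᶜ := by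
  obtain ⟨x, hx⟩ := hne
  refine ⟨p, hA.arcHull_subset_compl hx (left_mem_arcHull p x), fun {y} hy => ?_⟩
  obtain ⟨γ, hγ⟩ := hX.exists_path_range_eq_arcHull p y
  exact ⟨γ, fun t => hA.arcHull_subset_compl hy (hγ ▸ mem_range_self t)⟩

theorem IsDendroid.mem_nonblockers_iff (hX : IsDendroid X)
    (hp : ({p} : NonemptyCompacts X) ∉ shoreSingletons X) {A : NonemptyCompacts X} :
    A ∈ nonblockers X ↔ Dense (A : Set X)ᶜ ∧ IsArcUpperSet p (A : Set X) :=
  ⟨fun hA => ⟨dense_compl_of_mem_nonblockers hA, isArcUpperSet_of_mem_nonblockers hp hA⟩,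
    fun ⟨hd, hA⟩ =>
      mem_nonblockers_of_isPathConnected_compl (hX.isPathConnected_compl hA hd.nonempty) hd⟩

theorem nonblockersAt_eq_empty (hp : ({p} : NonemptyCompacts X) ∉ shoreSingletons X) :
    nonblockersAt p = ∅ := by
  refine eq_empty_of_forall_notMem fun A ⟨hA, hpA⟩ => hA.1 (NonemptyCompacts.ext ?_)
  exact (isArcUpperSet_of_mem_nonblockers hp hA).eq_univ_of_mem hpA

theorem minNonblocker_eq_top {a : X} (h : ¬ (nonblockersAt a).Nonempty) :
    minNonblocker a = ⊤ := if_neg h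

theorem coe_minNonblocker {a : X} (h : (nonblockersAt a).Nonempty) :
    (minNonblocker a : Set X) = ⋂ A ∈ nonblockersAt a, (A : Set X) := by
  rw [minNonblocker, if_pos h]
  rfl

theorem mem_minNonblocker {a : X} (h : (nonblockersAt a).Nonempty) :
    a ∈ (minNonblocker a : Set X) := by
  rw [coe_minNonblocker h]
  exact mem_iInter₂.2 fun _ hA => hA.2

theorem minNonblocker_subset {a : X} {A : NonemptyCompacts X} (hA : A ∈ nonblockersAt a) :
    (minNonblocker a : Set X) ⊆ A := by
  rw [coe_minNonblocker ⟨A, hA⟩]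
  exact biInter_subset_of_mem hA

namespace IsDendroid

theorem minNonblocker_mem_nonblockers (hX : IsDendroid X)
    (hp : ({p} : NonemptyCompacts X) ∉ shoreSingletons X) {a : X}
    (h : (nonblockersAt a).Nonempty) : minNonblocker a ∈ nonblockers X := by
  refine (hX.mem_nonblockers_iff hp).2 ⟨?_, ?_⟩
  · obtain ⟨A, hA⟩ := h
    exact (dense_compl_of_mem_nonblockers hA.1).mono
      (compl_subset_compl.2 (minNonblocker_subset hA))
  · rw [coe_minNonblocker h]
    exact IsArcUpperSet.biInter fun A hA => isArcUpperSet_of_mem_nonblockers hp hA.1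

/-- A component of a nonblocker is again a nonblocker, so minimality forces connectedness. -/
theorem isPreconnected_minNonblocker (hX : IsDendroid X)
    (hp : ({p} : NonemptyCompacts X) ∉ shoreSingletons X) {a : X}
    (h : (nonblockersAt a).Nonempty) : IsPreconnected (minNonblocker a : Set X) := by
  set M := minNonblocker a
  have hM : M ∈ nonblockers X := hX.minNonblocker_mem_nonblockers hp h
  have ha : a ∈ connectedComponentIn (M : Set X) a :=
    mem_connectedComponentIn (mem_minNonblocker h)
  let C : NonemptyCompacts X :=
    ⟨⟨connectedComponentIn (M : Set X) a,
      (isClosed_connectedComponentIn M.isCompact.isClosed a).isCompact⟩, ⟨a, ha⟩⟩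
  have hCM : (C : Set X) ⊆ M := connectedComponentIn_subset _ a
  have hC : C ∈ nonblockersAt a :=
    ⟨(hX.mem_nonblockers_iff hp).2
      ⟨(dense_compl_of_mem_nonblockers hM).mono (compl_subset_compl.2 hCM),
        hX.isArcUpperSet_connectedComponentIn (isArcUpperSet_of_mem_nonblockers hp hM) a⟩, ha⟩
  rw [(minNonblocker_subset hC).antisymm hCM]
  exact isPreconnected_connectedComponentIn

theorem minNonblocker_mem_connectedNonblockers (hX : IsDendroid X)
    (hp : ({p} : NonemptyCompacts X) ∉ shoreSingletons X) {a : X}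
    (h : (nonblockersAt a).Nonempty) : minNonblocker a ∈ connectedNonblockers X :=
  ⟨hX.minNonblocker_mem_nonblockers hp h, (minNonblocker a).nonempty,
    hX.isPreconnected_minNonblocker hp h⟩

theorem exists_minNonblocker_eq (hX : IsDendroid X)
    (hp : ({p} : NonemptyCompacts X) ∉ shoreSingletons X) {A : NonemptyCompacts X}
    (hA : A ∈ connectedNonblockers X) : ∃ a, minNonblocker a = A := by
  obtain ⟨a, ha, haA⟩ := hX.exists_mem_forall_mem_arcHull p A.isCompact.isClosed hA.2
  have hAa : A ∈ nonblockersAt a := ⟨hA.1, ha⟩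
  have hupper : IsArcUpperSet p (minNonblocker a : Set X) :=
    isArcUpperSet_of_mem_nonblockers hp (hX.minNonblocker_mem_nonblockers hp ⟨A, hAa⟩)
  exact ⟨a, NonemptyCompacts.ext ((minNonblocker_subset hAa).antisymm fun y hy =>
    hupper (haA y hy) (mem_minNonblocker ⟨A, hAa⟩))⟩

end IsDendroid

end Nonblockers

end Continuum

theorem mainTheorem9 (X : Type*) [MetricSpace X] [CompactSpace X] [ConnectedSpace X]
    (hX : Continuum.IsDendroid X)
    (hS : ∃ p : X, ({p} : TopologicalSpace.NonemptyCompacts X) ∉ Continuum.shoreSingletons X) :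
    Continuum.minNonblockers X = insert ⊤ (Continuum.connectedNonblockers X) := by
  obtain ⟨p, hp⟩ := hS
  refine Set.Subset.antisymm ?_ (Set.insert_subset ?_ fun A hA => hX.exists_minNonblocker_eq hp hA)
  · rintro _ ⟨a, rfl⟩
    by_cases h : (Continuum.nonblockersAt a).Nonempty
    · exact Or.inr (hX.minNonblocker_mem_connectedNonblockers hp h)
    · exact Or.inl (Continuum.minNonblocker_eq_top h)
  · exact ⟨p, Continuum.minNonblocker_eq_top <|
      Set.not_nonempty_iff_eq_empty.2 (Continuum.nonblockersAt_eq_empty hp)⟩
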